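/- For $f:\{0,1\}^n\to\{0,1\}$ let $\eta(f)=\min_{a\in\{0,1\}^n,\,b\in\{0,1\}}2^{-n}\,|\{x: f(x)\neq (a\cdot x)\oplus b\}|$ be its normalised non-linearity, let $\hat f(a)=2^{-n}\sum_x(-1)^{f(x)\oplus a\cdot x}$ be its Walsh coefficients, and let $\hat f_{\max}=\max_a|\hat f(a)|$. A $T$-query quantum algorithm starts in $|0\cdots 0\rangle$ on $n+1+m$ qubits ($m$ arbitrary), applies $T$ calls to the oracle $U_f:|x,b,w\rangle\mapsto|x,b\oplus f(x),w\rangle$ interleaved with arbitrary unitaries that do not depend on $f$, measures in the computational basis, and computes its output from the outcome. **Theorem.** Estimating the non-linearity of a Boolean function with additive accuracy $\lambda$ needs $\Omega(1/\sqrt\lambda)$ quantum queries. Precisely, for every error probability $\delta\in[0,\tfrac12)$ there is a constant $c>0$, depending only on $\delta$, such that the following hold for all $n$ and all $\lambda$ with $2^{-(n+1)}\le\lambda\le\tfrac18$. 1. If a $T$-query algorithm outputs, for every $f:\{0,1\}^n\to\{0,1\}$, with probability at least $1-\delta$ the endpoints of an interval of length at most $\lambda$ containing $\eta(f)$, then $T\ge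 c/\sqrt\lambda$. 2. If $\lambda<\tfrac18$ and a $T$-query algorithm outputs, for every $f:\{0,1\}^n\to\{0,1\}$, with probability at least $1-\delta$ a number $r$ with $|r-\eta(f)|\le\lambda$, then $T\ge c/\sqrt\lambda$. 3. If $2^{n+1}\lambda$ is an integer, every algorithm that decides with error probability at most $\delta$ whether $\hat f_{\max}=1$ or $\hat f_{\max}=1-4\lambda$, given the promise that one of these holds, uses at least $c/\sqrt\lambda$ queries. 4. If $2^{n+1}\lambda$ is an integer and $n$ is even, every algorithm that decides with error probability at most $\delta$ whether $\hat f_{\max}=2^{-n/2}$ (that is, $f$ is bent) or $\hat f_{\max}=2^{-n/2}+4\lambda$, given the promise that one of these holds, uses at least $c/\sqrt\lambda$ queries. -/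

import Mathlib

open scoped Matrix

/-- An `n`-bit Boolean function, bits being elements of `𝔽₂ = ZMod 2`. -/
abbrev BoolFun (n : ℕ) : Type := (Fin n → ZMod 2) → ZMod 2

namespace BoolFun

/-- The affine Boolean function `x ↦ a · x + b` over `𝔽₂`. -/
def affine {n : ℕ} (a : Fin n → ZMod 2) (b : ZMod 2) : BoolFun n :=
  fun x => a ⬝ᵥ x + b

/-- The normalised non-linearity: the minimum, over all affine functions (a finite nonempty
family), of the Hamming distance between truth tables, divided by `2 ^ n`. -/
noncomputable def nonlinearity {n : ℕ} (f : BoolFun n) : ℝ :=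
  ⨅ p : (Fin n → ZMod 2) × ZMod 2, (hammingDist f (affine p.1 p.2) : ℝ) / 2 ^ n

/-- The normalised Walsh coefficient `2⁻ⁿ ∑ₓ (-1) ^ (f x ⊕ x · a)`. -/
noncomputable def walsh {n : ℕ} (f : BoolFun n) (a : Fin n → ZMod 2) : ℝ :=
  (∑ x : Fin n → ZMod 2, (-1 : ℝ) ^ (f x + x ⬝ᵥ a).val) / 2 ^ n

/-- The largest absolute value of a Walsh coefficient. -/
noncomputable def walshMax {n : ℕ} (f : BoolFun n) : ℝ :=
  ⨆ a : Fin n → ZMod 2, |walsh f a|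

end BoolFun

/-- Labels `(x, b, w)` of the computational basis of a register made of `n` query input qubits,
one query output qubit and `m` work qubits. -/
abbrev RegBasis (n m : ℕ) : Type := (Fin n → ZMod 2) × ZMod 2 × (Fin m → ZMod 2)

/-- The oracle `U_f`, acting on amplitude vectors: the linear map with
`|x, b, w⟩ ↦ |x, b ⊕ f x, w⟩` (see `oracle_single`). -/
def oracle {n m : ℕ} (f : BoolFun n) (ψ : RegBasis n m → ℂ) : RegBasis n m → ℂ :=
  fun z => ψ (z.1, z.2.1 - f z.1, z.2.2)

theorem oracle_single {n m : ℕ} (f : BoolFun n) (x : Fin n → ZMod 2) (b : ZMod 2)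
    (w : Fin m → ZMod 2) :
    oracle f (Pi.single (x, b, w) 1) = Pi.single (x, b + f x, w) 1 := by
  funext z
  obtain ⟨x', b', w'⟩ := z
  simp only [oracle, Pi.single_apply, Prod.mk.injEq]
  congr 1
  apply propext
  constructor
  · rintro ⟨rfl, h, rfl⟩
    exact ⟨rfl, by rw [← h]; ring, rfl⟩
  · rintro ⟨rfl, h, rfl⟩
    exact ⟨rfl, by rw [h]; ring, rfl⟩

/-- A quantum query algorithm for `n`-bit Boolean functions with outputs in `α`. It starts in
`|0…0⟩`, applies `gate 0`, then `queries` times the oracle, the `t`-th call being followed by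
`gate t`; finally all qubits are measured in the computational basis and the outcome `z` is
turned into the output `out z`. The gates are arbitrary unitaries that do not depend on the
oracle, and the number of work qubits is arbitrary. -/
structure QueryAlgorithm (n : ℕ) (α : Type) where
  workQubits : ℕ
  queries : ℕ
  gate : ℕ → Matrix.unitaryGroup (RegBasis n workQubits) ℂ
  out : RegBasis n workQubits → α

namespace QueryAlgorithm

/-- The state after `t` oracle calls and the gate that follows them. -/
noncomputable def state {n : ℕ} {α : Type} (A : QueryAlgorithm n α) (f : BoolFun n) :
    ℕ → RegBasis n A.workQubits → ℂ
  | 0 => (A.gate 0).1 *ᵥ Pi.single 0 1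
  | t + 1 => (A.gate (t + 1)).1 *ᵥ oracle f (A.state f t)

open Classical in
/-- The probability (Born rule) that the output of `A` with oracle `f` lies in `S`. -/
noncomputable def prob {n : ℕ} {α : Type} (A : QueryAlgorithm n α) (f : BoolFun n)
    (S : Set α) : ℝ :=
  ∑ z : RegBasis n A.workQubits, if A.out z ∈ S then ‖A.state f A.queries z‖ ^ 2 else 0

/-- On every oracle `f` the algorithm outputs, with probability at least `1 - δ`, the endpoints
of an interval of length at most `lam` that contains the non-linearity of `f`. -/
def EstimatesByInterval {n : ℕ} (A : QueryAlgorithm n (ℝ × ℝ)) (lam δ : ℝ) : Prop :=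
  ∀ f : BoolFun n,
    1 - δ ≤ A.prob f {I | I.2 - I.1 ≤ lam ∧ f.nonlinearity ∈ Set.Icc I.1 I.2}

/-- On every oracle `f` the algorithm outputs, with probability at least `1 - δ`, a number within
`lam` of the non-linearity of `f`. -/
def EstimatesByNumber {n : ℕ} (A : QueryAlgorithm n ℝ) (lam δ : ℝ) : Prop :=
  ∀ f : BoolFun n, 1 - δ ≤ A.prob f {r | |r - f.nonlinearity| ≤ lam}

/-- With error probability at most `δ`, the algorithm decides whether `walshMax f = u` or
`walshMax f = v`, under the promise that one of the two holds. -/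
def DecidesWalshMax {n : ℕ} (A : QueryAlgorithm n Bool) (u v δ : ℝ) : Prop :=
  ∀ f : BoolFun n,
    (f.walshMax = u → 1 - δ ≤ A.prob f {true}) ∧
    (f.walshMax = v → 1 - δ ≤ A.prob f {false})

end QueryAlgorithm

/-!
The lower bound is a hybrid argument in the style of Bennett, Bernstein, Brassard and Vazirani.
The queries of a `T`-query algorithm run on `f` carry total weight `T`, so in any set `D` of inputs
some `k` points carry weight at most `T * k / #D`. Flipping `f` at these points moves the final
state by at most `2 * T * √(k / #D)`, whereas an algorithm that separates the two functions must
move it by a constant; hence `T` is of order at least `√(#D / k)`.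

The non-linearity is `(1 - walshMax) / 2`, so it remains to choose `f` and `D` such that flipping
*any* `k` points of `D` changes `walshMax` by exactly `2 * k / 2 ^ n`. For `f = 0` and `D`
everything, the affine function closest to the flipped function is still `0`, as long as
`k ≤ 2 ^ n / 4`. For `f` bent and `D` the set on which `f` takes the value that lowers the absolute
value of its Walsh coefficient at `0`, every flip in `D` enlarges that absolute value by
`2 / 2 ^ n`, and no other coefficient can grow faster.
-/

open WithLp Finset

section EuclideanSpace

variable {ι : Type*} [Fintype ι]

theorem norm_toLp_unitary_mulVec [DecidableEq ι] (U : Matrix.unitaryGroup ι ℂ) (ψ : ι → ℂ) :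
    ‖toLp 2 (U.1 *ᵥ ψ)‖ = ‖toLp 2 ψ‖ := by
  rw [← Matrix.toEuclideanCLM_toLp (𝕜 := ℂ)]
  exact ContinuousLinearMap.norm_map_of_mem_unitary (Unitary.map_mem _ U.2) _

theorem norm_toLp_indicator_le (s : Set ι) (ψ : ι → ℂ) :
    ‖toLp 2 (s.indicator ψ)‖ ≤ ‖toLp 2 ψ‖ := by
  rw [EuclideanSpace.norm_eq, EuclideanSpace.norm_eq]
  gcongr
  exact norm_indicator_le_norm_self ψ _

theorem norm_toLp_indicator_sq_sub_le (s : Set ι) {ψ φ : ι → ℂ} (hψ : ‖toLp 2 ψ‖ ≤ 1)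
    (hφ : ‖toLp 2 φ‖ ≤ 1) :
    ‖toLp 2 (s.indicator ψ)‖ ^ 2 - ‖toLp 2 (s.indicator φ)‖ ^ 2
      ≤ 2 * ‖toLp 2 ψ - toLp 2 φ‖ := by
  have hsub : ‖toLp 2 (s.indicator ψ)‖ - ‖toLp 2 (s.indicator φ)‖ ≤ ‖toLp 2 ψ - toLp 2 φ‖ :=
    calc _ ≤ ‖toLp 2 (s.indicator ψ) - toLp 2 (s.indicator φ)‖ := norm_sub_norm_le _ _
      _ = ‖toLp 2 (s.indicator (ψ - φ))‖ := by rw [Set.indicator_sub', toLp_sub]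
      _ ≤ ‖toLp 2 ψ - toLp 2 φ‖ := norm_toLp_indicator_le s (ψ - φ)
  have hadd : ‖toLp 2 (s.indicator ψ)‖ + ‖toLp 2 (s.indicator φ)‖ ≤ 2 := by
    linarith [norm_toLp_indicator_le s ψ, norm_toLp_indicator_le s φ]
  calc ‖toLp 2 (s.indicator ψ)‖ ^ 2 - ‖toLp 2 (s.indicator φ)‖ ^ 2
      = (‖toLp 2 (s.indicator ψ)‖ + ‖toLp 2 (s.indicator φ)‖)
          * (‖toLp 2 (s.indicator ψ)‖ - ‖toLp 2 (s.indicator φ)‖) := sq_sub_sq _ _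
    _ ≤ (‖toLp 2 (s.indicator ψ)‖ + ‖toLp 2 (s.indicator φ)‖) * ‖toLp 2 ψ - toLp 2 φ‖ := by
        gcongr
    _ ≤ 2 * ‖toLp 2 ψ - toLp 2 φ‖ := by gcongr

end EuclideanSpace

theorem exists_subset_card_mul_sum_le {ι R : Type*} [CommRing R] [LinearOrder R]
    [IsStrictOrderedRing R] (w : ι → R) (D : Finset ι) {k : ℕ} (hk : k ≤ #D) :
    ∃ S ⊆ D, #S = k ∧ #D * ∑ x ∈ S, w x ≤ k * ∑ x ∈ D, w x := by
  classical
  induction hk using Nat.decreasingInduction with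
  | self => exact ⟨D, subset_rfl, rfl, le_rfl⟩
  | of_succ k _ ih =>
    obtain ⟨S, hSD, hSk, hS⟩ := ih
    obtain ⟨a, haS, hmax⟩ := exists_max_image S w (card_pos.mp (by omega))
    refine ⟨S.erase a, (erase_subset a S).trans hSD, by rw [card_erase_of_mem haS]; omega, ?_⟩
    have hsum : ∑ x ∈ S.erase a, w x = ∑ x ∈ S, w x - w a := sum_erase_eq_sub haS
    have havg : ∑ x ∈ S, w x ≤ (k + 1) * w a := by
      simpa [hSk] using sum_le_card_nsmul S w (w a) hmax
    have hpos : (0 : R) < k + 1 := by positivity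
    push_cast at hS
    refine le_of_mul_le_mul_left ?_ hpos
    calc (k + 1) * (#D * ∑ x ∈ S.erase a, w x)
        = #D * ((k + 1) * ∑ x ∈ S, w x - (k + 1) * w a) := by rw [hsum]; ring
      _ ≤ #D * ((k + 1) * ∑ x ∈ S, w x - ∑ x ∈ S, w x) := by gcongr
      _ = k * (#D * ∑ x ∈ S, w x) := by ring
      _ ≤ k * ((k + 1) * ∑ x ∈ D, w x) := by gcongr
      _ = (k + 1) * (k * ∑ x ∈ D, w x) := by ring

section Oracle

variable {n m : ℕ}

/-- The probability that measuring the query input qubits of the state `ψ` gives `x`. -/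
noncomputable def queryWeight (ψ : RegBasis n m → ℂ) (x : Fin n → ZMod 2) : ℝ :=
  ∑ y : ZMod 2 × (Fin m → ZMod 2), ‖ψ (x, y)‖ ^ 2

theorem queryWeight_nonneg (ψ : RegBasis n m → ℂ) (x : Fin n → ZMod 2) : 0 ≤ queryWeight ψ x :=
  sum_nonneg fun _ _ => sq_nonneg _

theorem sum_queryWeight (ψ : RegBasis n m → ℂ) : ∑ x, queryWeight ψ x = ‖toLp 2 ψ‖ ^ 2 := by
  rw [EuclideanSpace.norm_sq_eq, Fintype.sum_prod_type]
  rfl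

theorem queryWeight_oracle (f : BoolFun n) (ψ : RegBasis n m → ℂ) (x : Fin n → ZMod 2) :
    queryWeight (oracle f ψ) x = queryWeight ψ x := by
  simp only [queryWeight, oracle, Fintype.sum_prod_type]
  exact (Equiv.subRight (f x)).sum_comp fun b => ∑ w, ‖ψ (x, b, w)‖ ^ 2

theorem norm_toLp_oracle (f : BoolFun n) (ψ : RegBasis n m → ℂ) :
    ‖toLp 2 (oracle f ψ)‖ = ‖toLp 2 ψ‖ := by
  rw [← sq_eq_sq₀ (norm_nonneg _) (norm_nonneg _), ← sum_queryWeight, ← sum_queryWeight]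
  simp only [queryWeight_oracle]

theorem norm_toLp_oracle_sub_oracle (f : BoolFun n) (ψ φ : RegBasis n m → ℂ) :
    ‖toLp 2 (oracle f ψ) - toLp 2 (oracle f φ)‖ = ‖toLp 2 ψ - toLp 2 φ‖ :=
  norm_toLp_oracle f (ψ - φ)

theorem norm_toLp_indicator_sq (S : Finset (Fin n → ZMod 2)) (ψ : RegBasis n m → ℂ) :
    ‖toLp 2 ({z | z.1 ∈ S}.indicator ψ)‖ ^ 2 = ∑ x ∈ S, queryWeight ψ x := by
  rw [← sum_queryWeight, ← sum_subset (subset_univ S)]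
  · exact sum_congr rfl fun x hx => by simp [queryWeight, hx]
  · exact fun x _ hx => by simp [queryWeight, hx]

theorem norm_oracle_sub_oracle_le {f g : BoolFun n} {S : Finset (Fin n → ZMod 2)}
    (hfg : ∀ x ∉ S, f x = g x) (ψ : RegBasis n m → ℂ) :
    ‖toLp 2 (oracle f ψ) - toLp 2 (oracle g ψ)‖ ≤ 2 * ‖toLp 2 ({z | z.1 ∈ S}.indicator ψ)‖ := by
  set φ := {z : RegBasis n m | z.1 ∈ S}.indicator ψ
  have hφ : oracle f ψ - oracle g ψ = oracle f φ - oracle g φ := by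
    funext z
    by_cases hz : z.1 ∈ S <;> simp [φ, oracle, Set.indicator, hz, hfg]
  calc ‖toLp 2 (oracle f ψ) - toLp 2 (oracle g ψ)‖
      = ‖toLp 2 (oracle f φ) - toLp 2 (oracle g φ)‖ := by rw [← toLp_sub, hφ, toLp_sub]
    _ ≤ ‖toLp 2 (oracle f φ)‖ + ‖toLp 2 (oracle g φ)‖ := norm_sub_le _ _
    _ = 2 * ‖toLp 2 φ‖ := by rw [norm_toLp_oracle, norm_toLp_oracle, two_mul]

end Oracle

/-- The function obtained from `f` by flipping its values on `S`. -/
def BoolFun.flipOn {n : ℕ} (f : BoolFun n) (S : Finset (Fin n → ZMod 2)) : BoolFun n :=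
  fun x => if x ∈ S then f x + 1 else f x

namespace QueryAlgorithm

variable {n : ℕ} {α : Type}

theorem norm_toLp_state (A : QueryAlgorithm n α) (f : BoolFun n) (t : ℕ) :
    ‖toLp 2 (A.state f t)‖ = 1 := by
  induction t with
  | zero =>
    rw [state, norm_toLp_unitary_mulVec]
    exact (PiLp.norm_single 2 _ 0 1).trans norm_one
  | succ t ih => rw [state, norm_toLp_unitary_mulVec, norm_toLp_oracle, ih]

/-- The total query magnitude of Bennett, Bernstein, Brassard and Vazirani: the sum, over all
queries made by `A` to `f`, of the probability that the query is at `x`. -/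
noncomputable def queryMagnitude (A : QueryAlgorithm n α) (f : BoolFun n) (x : Fin n → ZMod 2) :
    ℝ :=
  ∑ t ∈ range A.queries, queryWeight (A.state f t) x

theorem sum_queryMagnitude_le (A : QueryAlgorithm n α) (f : BoolFun n)
    (D : Finset (Fin n → ZMod 2)) : ∑ x ∈ D, A.queryMagnitude f x ≤ A.queries := by
  calc ∑ x ∈ D, A.queryMagnitude f x ≤ ∑ x, A.queryMagnitude f x :=
        sum_le_univ_sum_of_nonneg fun x => sum_nonneg fun t _ => queryWeight_nonneg _ _
    _ = ∑ t ∈ range A.queries, ‖toLp 2 (A.state f t)‖ ^ 2 := by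
        simp only [queryMagnitude, ← sum_queryWeight]
        exact sum_comm
    _ = A.queries := by simp [norm_toLp_state]

theorem norm_state_sub_state_le (A : QueryAlgorithm n α) (f g : BoolFun n) (t : ℕ) :
    ‖toLp 2 (A.state f t) - toLp 2 (A.state g t)‖
      ≤ ∑ i ∈ range t,
          ‖toLp 2 (oracle f (A.state f i)) - toLp 2 (oracle g (A.state f i))‖ := by
  induction t with
  | zero => simp [state]
  | succ t ih =>
    rw [sum_range_succ, state, state, ← toLp_sub, ← Matrix.mulVec_sub, norm_toLp_unitary_mulVec,
      toLp_sub]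
    calc _ ≤ ‖toLp 2 (oracle f (A.state f t)) - toLp 2 (oracle g (A.state f t))‖
          + ‖toLp 2 (oracle g (A.state f t)) - toLp 2 (oracle g (A.state g t))‖ :=
          norm_sub_le_norm_sub_add_norm_sub _ _ _
      _ ≤ _ := by
          rw [norm_toLp_oracle_sub_oracle, add_comm]
          gcongr

theorem norm_state_sub_state_sq_le (A : QueryAlgorithm n α) {f g : BoolFun n}
    {S : Finset (Fin n → ZMod 2)} (hfg : ∀ x ∉ S, f x = g x) :
    ‖toLp 2 (A.state f A.queries) - toLp 2 (A.state g A.queries)‖ ^ 2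
      ≤ 4 * A.queries * ∑ x ∈ S, A.queryMagnitude f x := by
  set T := A.queries
  let p : ℕ → ℝ := fun t => ‖toLp 2 ({z | z.1 ∈ S}.indicator (A.state f t))‖
  have hp : ∑ t ∈ range T, p t ^ 2 = ∑ x ∈ S, A.queryMagnitude f x := by
    simp only [p, norm_toLp_indicator_sq, queryMagnitude]
    exact sum_comm
  calc ‖toLp 2 (A.state f T) - toLp 2 (A.state g T)‖ ^ 2
      ≤ (∑ t ∈ range T, 2 * p t) ^ 2 := by
        gcongr
        exact (A.norm_state_sub_state_le f g T).trans
          (sum_le_sum fun t _ => norm_oracle_sub_oracle_le hfg _)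
    _ = 4 * (∑ t ∈ range T, p t) ^ 2 := by rw [← mul_sum]; ring
    _ ≤ 4 * (T * ∑ t ∈ range T, p t ^ 2) := by
        gcongr
        simpa using sq_sum_le_card_mul_sum_sq (s := range T) (f := p)
    _ = 4 * T * ∑ x ∈ S, A.queryMagnitude f x := by rw [hp, mul_assoc]

theorem exists_flipOn_norm_state_sub_sq_le (A : QueryAlgorithm n α) (f : BoolFun n)
    {D : Finset (Fin n → ZMod 2)} {k : ℕ} (hk : k ≤ #D) :
    ∃ S ⊆ D, #S = k ∧
      #D * ‖toLp 2 (A.state f A.queries) - toLp 2 (A.state (f.flipOn S) A.queries)‖ ^ 2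
        ≤ 4 * A.queries ^ 2 * k := by
  obtain ⟨S, hSD, hSk, hS⟩ := exists_subset_card_mul_sum_le (A.queryMagnitude f) D hk
  have hflip : ∀ x ∉ S, f x = f.flipOn S x := fun x hx => (if_neg hx).symm
  refine ⟨S, hSD, hSk, ?_⟩
  calc _ ≤ #D * (4 * A.queries * ∑ x ∈ S, A.queryMagnitude f x) := by
        gcongr
        exact A.norm_state_sub_state_sq_le hflip
    _ = 4 * A.queries * (#D * ∑ x ∈ S, A.queryMagnitude f x) := by ring
    _ ≤ 4 * A.queries * (k * ∑ x ∈ D, A.queryMagnitude f x) := by gcongr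
    _ ≤ 4 * A.queries * (k * A.queries) := by
        gcongr
        exact A.sum_queryMagnitude_le f D
    _ = 4 * A.queries ^ 2 * k := by ring

theorem prob_eq_norm_sq (A : QueryAlgorithm n α) (f : BoolFun n) (R : Set α) :
    A.prob f R = ‖toLp 2 ((A.out ⁻¹' R).indicator (A.state f A.queries))‖ ^ 2 := by
  classical
  simp [prob, EuclideanSpace.norm_sq_eq, Set.indicator, apply_ite]

theorem prob_sub_prob_le (A : QueryAlgorithm n α) (f g : BoolFun n) (R : Set α) :
    A.prob f R - A.prob g R
      ≤ 2 * ‖toLp 2 (A.state f A.queries) - toLp 2 (A.state g A.queries)‖ := by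
  rw [prob_eq_norm_sq, prob_eq_norm_sq]
  exact norm_toLp_indicator_sq_sub_le _ (A.norm_toLp_state f _).le (A.norm_toLp_state g _).le

theorem prob_add_prob_le_one (A : QueryAlgorithm n α) (f : BoolFun n) {R R' : Set α}
    (h : Disjoint R R') : A.prob f R + A.prob f R' ≤ 1 := by
  have hnorm : ∑ z, ‖A.state f A.queries z‖ ^ 2 = 1 := by
    simpa [norm_toLp_state] using (EuclideanSpace.norm_sq_eq (toLp 2 (A.state f A.queries))).symm
  rw [prob, prob, ← sum_add_distrib, ← hnorm]
  refine sum_le_sum fun z _ => ?_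
  by_cases hz : A.out z ∈ R
  · simp [hz, Set.disjoint_left.mp h hz]
  · rw [if_neg hz, zero_add]
    split_ifs <;> simp

theorem mul_sqrt_card_le_queries_mul_sqrt (A : QueryAlgorithm n α) {f : BoolFun n}
    {D : Finset (Fin n → ZMod 2)} {k : ℕ} (hk : k ≤ #D) {δ : ℝ} {R R' : Set α}
    (hR : Disjoint R R') (hf : 1 - δ ≤ A.prob f R)
    (hflip : ∀ S ⊆ D, #S = k → 1 - δ ≤ A.prob (f.flipOn S) R') :
    (1 - 2 * δ) * √(#D) ≤ 4 * A.queries * √k := by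
  obtain ⟨S, hSD, hSk, hS⟩ := A.exists_flipOn_norm_state_sub_sq_le f hk
  set a := ‖toLp 2 (A.state f A.queries) - toLp 2 (A.state (f.flipOn S) A.queries)‖
  have hgap : 1 - 2 * δ ≤ 2 * a := by
    have hdist := A.prob_sub_prob_le f (f.flipOn S) R
    have hdisj := A.prob_add_prob_le_one (f.flipOn S) hR
    linarith [hflip S hSD hSk]
  have hclose : a * √(#D) ≤ 2 * A.queries * √k := by
    refine le_of_sq_le_sq ?_ (by positivity)
    rw [mul_pow, mul_pow, mul_pow, Real.sq_sqrt (Nat.cast_nonneg _),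
      Real.sq_sqrt (Nat.cast_nonneg _)]
    linarith
  calc (1 - 2 * δ) * √(#D) ≤ 2 * a * √(#D) := by gcongr
    _ ≤ 4 * A.queries * √k := by linarith

theorem div_sqrt_le_queries (A : QueryAlgorithm n α) {f : BoolFun n}
    {D : Finset (Fin n → ZMod 2)} {k : ℕ} (hk : k ≤ #D) (hD : 0 < #D) {lam δ : ℝ}
    (hlam : 0 < lam) (hklam : k ≤ 16 * lam * #D) {R R' : Set α} (hR : Disjoint R R')
    (hf : 1 - δ ≤ A.prob f R)
    (hflip : ∀ S ⊆ D, #S = k → 1 - δ ≤ A.prob (f.flipOn S) R') :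
    (1 - 2 * δ) / 16 / √lam ≤ A.queries := by
  have hsqrt : √(k : ℝ) ≤ 4 * √lam * √(#D) := by
    refine Real.sqrt_le_iff.mpr ⟨by positivity, hklam.trans_eq ?_⟩
    rw [mul_pow, mul_pow, Real.sq_sqrt hlam.le, Real.sq_sqrt (Nat.cast_nonneg _)]
    norm_num
  have hmul : (1 - 2 * δ) * √(#D) ≤ A.queries * (16 * √lam) * √(#D) :=
    calc (1 - 2 * δ) * √(#D) ≤ 4 * A.queries * √k :=
          A.mul_sqrt_card_le_queries_mul_sqrt hk hR hf hflip
      _ ≤ 4 * A.queries * (4 * √lam * √(#D)) := by gcongr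
      _ = A.queries * (16 * √lam) * √(#D) := by ring
  rw [div_div, div_le_iff₀ (by positivity)]
  exact le_of_mul_le_mul_right hmul (by positivity)

end QueryAlgorithm

section SignCharacter

theorem sum_addChar_dotProduct {ι R R' : Type*} [Fintype ι] [DecidableEq ι] [CommRing R] [Fintype R]
    [DecidableEq R] [CommRing R'] [IsDomain R'] {χ : AddChar R R'} (hχ : χ.IsPrimitive)
    (a : ι → R) :
    ∑ x : ι → R, χ (x ⬝ᵥ a) = if a = 0 then (Fintype.card (ι → R) : R') else 0 := by
  let χa : AddChar (ι → R) R' := χ.compAddMonoidHom (dotProductEquiv R ι a).toAddMonoidHom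
  have hχa : ∀ x, χa x = χ (x ⬝ᵥ a) := fun x => congrArg χ (dotProduct_comm a x)
  have hzero : χa = 0 ↔ a = 0 := by
    refine ⟨fun h => ?_, fun h => ?_⟩
    · by_contra ha
      obtain ⟨i, hi⟩ := Function.ne_iff.mp ha
      obtain ⟨r, hr⟩ := AddChar.ne_one_iff.mp (hχ hi)
      refine hr ?_
      have := hχa (Pi.single i r)
      rw [h, single_dotProduct, mul_comm] at this
      exact this.symm
    · ext x
      simp [hχa, h]
  simp only [← hχa, AddChar.sum_eq_ite, hzero]

/-- The sign character `b ↦ (-1) ^ b` of `𝔽₂`. -/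
noncomputable def signChar : AddChar (ZMod 2) ℝ :=
  AddChar.zmodChar 2 (ζ := -1) (by norm_num)

theorem signChar_isPrimitive : signChar.IsPrimitive :=
  AddChar.zmodChar_primitive_of_primitive_root 2 (IsPrimitiveRoot.neg_one 0 two_ne_zero.symm)

theorem signChar_one : signChar 1 = -1 := by
  simp [signChar, AddChar.zmodChar_apply, ZMod.val_one]

theorem signChar_eq_one_or (b : ZMod 2) : signChar b = 1 ∨ signChar b = -1 :=
  neg_one_pow_eq_or ℝ _

theorem abs_signChar (b : ZMod 2) : |signChar b| = 1 := by
  rcases signChar_eq_one_or b with h | h <;> simp [h]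

theorem signChar_mul_self (b : ZMod 2) : signChar b * signChar b = 1 := by
  rw [← abs_mul_abs_self, abs_signChar, one_mul]

theorem exists_signChar_mul_eq_abs (r : ℝ) : ∃ b, signChar b * r = |r| := by
  rcases abs_choice r with h | h
  · exact ⟨0, by rw [AddChar.map_zero_eq_one, one_mul, h]⟩
  · exact ⟨1, by rw [signChar_one, neg_one_mul, h]⟩

theorem card_filter_eq_sum_signChar {X : Type*} [Fintype X] (g : X → ZMod 2) (b : ZMod 2) :
    (#{x | g x = b} : ℝ) = (Fintype.card X + signChar b * ∑ x, signChar (g x)) / 2 := by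
  have hbit : ∀ u v : ZMod 2,
      (if u = v then 1 else 0 : ℝ) = (1 + signChar v * signChar u) / 2 := by
    intro u v
    obtain rfl | rfl : u = v ∨ u = v + 1 := by decide +revert
    · rw [if_pos rfl, signChar_mul_self]; norm_num
    · simp [AddChar.map_add_eq_mul, signChar_mul_self, signChar_one]
  calc (#{x | g x = b} : ℝ) = ∑ x, (1 + signChar b * signChar (g x)) / 2 := by
        rw [← sum_boole]
        exact sum_congr rfl fun x _ => hbit _ _
    _ = (Fintype.card X + signChar b * ∑ x, signChar (g x)) / 2 := by
        rw [← sum_div, sum_add_distrib, ← mul_sum]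
        simp

end SignCharacter

namespace BoolFun

variable {n : ℕ}

theorem walsh_eq_sum_signChar (f : BoolFun n) (a : Fin n → ZMod 2) :
    f.walsh a = (∑ x, signChar (f x + x ⬝ᵥ a)) / 2 ^ n := rfl

theorem hammingDist_affine (f : BoolFun n) (a : Fin n → ZMod 2) (b : ZMod 2) :
    (hammingDist f (affine a b) : ℝ) / 2 ^ n = (1 - signChar b * f.walsh a) / 2 := by
  have hdist : hammingDist f (affine a b) = #{x | f x + x ⬝ᵥ a = b + 1} := by
    have hbit : ∀ u v b : ZMod 2, u ≠ v + b ↔ u + v = b + 1 := by decide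
    simp only [hammingDist, affine, hbit, dotProduct_comm a]
  rw [hdist, card_filter_eq_sum_signChar, walsh_eq_sum_signChar, AddChar.map_add_eq_mul,
    signChar_one, Fintype.card_pi_const, ZMod.card]
  push_cast
  field_simp
  ring

theorem abs_walsh_le_walshMax (f : BoolFun n) (a : Fin n → ZMod 2) : |f.walsh a| ≤ f.walshMax :=
  le_ciSup (f := fun a => |f.walsh a|) (Set.finite_range _).bddAbove a

theorem walshMax_eq_of_forall_le {f : BoolFun n} {a : Fin n → ZMod 2} {v : ℝ}
    (ha : |f.walsh a| = v) (h : ∀ b, |f.walsh b| ≤ v) : f.walshMax = v :=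
  le_antisymm (ciSup_le h) (ha ▸ f.abs_walsh_le_walshMax a)

theorem nonlinearity_eq (f : BoolFun n) : f.nonlinearity = (1 - f.walshMax) / 2 := by
  simp only [nonlinearity, hammingDist_affine]
  apply le_antisymm
  · obtain ⟨a, ha⟩ := exists_eq_ciSup_of_finite (f := fun a => |f.walsh a|)
    obtain ⟨b, hb⟩ := exists_signChar_mul_eq_abs (f.walsh a)
    refine (ciInf_le (Set.finite_range _).bddBelow (a, b)).trans_eq ?_
    rw [hb, walshMax, ← ha]
  · refine le_ciInf fun p => ?_
    have hp : signChar p.2 * f.walsh p.1 ≤ f.walshMax :=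
      calc signChar p.2 * f.walsh p.1 ≤ |signChar p.2 * f.walsh p.1| := le_abs_self _
        _ = |f.walsh p.1| := by rw [abs_mul, abs_signChar, one_mul]
        _ ≤ f.walshMax := f.abs_walsh_le_walshMax p.1
    gcongr

theorem walsh_flipOn (f : BoolFun n) (S : Finset (Fin n → ZMod 2)) (a : Fin n → ZMod 2) :
    (f.flipOn S).walsh a = f.walsh a - 2 * (∑ x ∈ S, signChar (f x + x ⬝ᵥ a)) / 2 ^ n := by
  have hterm : ∀ x, signChar (f.flipOn S x + x ⬝ᵥ a) = signChar (f x + x ⬝ᵥ a)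
      - 2 * if x ∈ S then signChar (f x + x ⬝ᵥ a) else 0 := by
    intro x
    by_cases hx : x ∈ S
    · simp only [flipOn, if_pos hx, AddChar.map_add_eq_mul, signChar_one]
      ring
    · simp only [flipOn, if_neg hx, mul_zero, sub_zero]
  simp only [walsh_eq_sum_signChar, hterm, sum_sub_distrib, ← mul_sum, sum_ite_mem, univ_inter,
    sub_div]

theorem walsh_flipOn_zero {f : BoolFun n} {S : Finset (Fin n → ZMod 2)} {b : ZMod 2}
    (hS : ∀ x ∈ S, f x = b) :
    (f.flipOn S).walsh 0 = f.walsh 0 - signChar b * (2 * #S / 2 ^ n) := by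
  have hsum : ∑ x ∈ S, signChar (f x + x ⬝ᵥ 0) = #S * signChar b := by
    rw [sum_congr rfl fun x hx => by rw [dotProduct_zero, add_zero, hS x hx], sum_const,
      nsmul_eq_mul]
  rw [walsh_flipOn, hsum]
  ring

theorem abs_walsh_flipOn_le (f : BoolFun n) (S : Finset (Fin n → ZMod 2)) (a : Fin n → ZMod 2) :
    |(f.flipOn S).walsh a| ≤ |f.walsh a| + 2 * #S / 2 ^ n := by
  have hsum : |∑ x ∈ S, signChar (f x + x ⬝ᵥ a)| ≤ #S :=
    (abs_sum_le_sum_abs _ _).trans_eq (by simp [abs_signChar])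
  rw [walsh_flipOn]
  refine (abs_sub _ _).trans ?_
  rw [abs_div, abs_mul, abs_two, abs_of_pos (by positivity : (0 : ℝ) < 2 ^ n)]
  gcongr

theorem walsh_zero (a : Fin n → ZMod 2) : (0 : BoolFun n).walsh a = if a = 0 then 1 else 0 := by
  simp only [walsh_eq_sum_signChar, Pi.zero_apply, zero_add,
    sum_addChar_dotProduct signChar_isPrimitive]
  split_ifs <;> simp

theorem walshMax_flipOn_zero {S : Finset (Fin n → ZMod 2)} (hS : 4 * #S ≤ 2 ^ n) :
    ((0 : BoolFun n).flipOn S).walshMax = 1 - 2 * #S / 2 ^ n := by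
  have hhalf : 2 * (#S : ℝ) / 2 ^ n ≤ 1 / 2 := by
    have hS' : (4 * #S : ℝ) ≤ 2 ^ n := by exact_mod_cast hS
    rw [div_le_div_iff₀ (by positivity) (by norm_num)]
    linarith
  have hzero : |((0 : BoolFun n).flipOn S).walsh 0| = 1 - 2 * #S / 2 ^ n := by
    rw [walsh_flipOn_zero (f := 0) (b := 0) fun _ _ => rfl, walsh_zero, if_pos rfl,
      AddChar.map_zero_eq_one, one_mul]
    exact abs_of_nonneg (by linarith)
  refine walshMax_eq_of_forall_le hzero fun b => ?_
  by_cases hb : b = 0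
  · rw [hb, hzero]
  · have hle := abs_walsh_flipOn_le 0 S b
    rw [walsh_zero, if_neg hb, abs_zero, zero_add] at hle
    linarith

theorem walshMax_zero : (0 : BoolFun n).walshMax = 1 := by
  refine walshMax_eq_of_forall_le (a := 0) (by simp [walsh_zero]) fun b => ?_
  rw [walsh_zero]
  split_ifs <;> simp

theorem nonlinearity_zero : (0 : BoolFun n).nonlinearity = 0 := by
  rw [nonlinearity_eq, walshMax_zero, sub_self, zero_div]

theorem nonlinearity_flipOn_zero {S : Finset (Fin n → ZMod 2)} (hS : 4 * #S ≤ 2 ^ n) :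
    ((0 : BoolFun n).flipOn S).nonlinearity = #S / 2 ^ n := by
  rw [nonlinearity_eq, walshMax_flipOn_zero hS]
  ring

/-- Bent functions: all Walsh coefficients have the same absolute value, which is `2 ^ (-n / 2)`
by Parseval's identity. -/
def IsBent (f : BoolFun n) : Prop :=
  ∀ a, |f.walsh a| = 1 / √(2 ^ n)

theorem IsBent.walshMax_eq {f : BoolFun n} (hf : f.IsBent) : f.walshMax = 1 / √(2 ^ n) :=
  walshMax_eq_of_forall_le (hf 0) fun a => (hf a).le

/-- The inner product of the two halves of the input, the standard bent function in even
dimension. -/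
def innerProduct (r : ℕ) : BoolFun (r + r) :=
  fun x => (fun i => x (Fin.castAdd r i)) ⬝ᵥ fun i => x (Fin.natAdd r i)

theorem isBent_innerProduct (r : ℕ) : (innerProduct r).IsBent := by
  intro c
  obtain ⟨⟨a, b⟩, rfl⟩ := (Fin.appendEquiv r r).surjective c
  have hexp : ∀ y z : Fin r → ZMod 2,
      innerProduct r (Fin.append y z) + Fin.append y z ⬝ᵥ Fin.append a b
        = y ⬝ᵥ (z + a) + z ⬝ᵥ b := by
    intro y z
    simp only [dotProduct_add, add_assoc]
    simp only [innerProduct, dotProduct, Fin.sum_univ_add, Fin.append_left, Fin.append_right]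
  have hsum : ∑ x, signChar (innerProduct r x + x ⬝ᵥ Fin.append a b)
      = 2 ^ r * signChar (-a ⬝ᵥ b) :=
    calc _ = ∑ z, ∑ y, signChar (y ⬝ᵥ (z + a)) * signChar (z ⬝ᵥ b) := by
          rw [← (Fin.appendEquiv r r).sum_comp, Fintype.sum_prod_type_right]
          simp only [← AddChar.map_add_eq_mul, ← hexp]
          rfl
      _ = ∑ z, (if z = -a then (2 ^ r : ℝ) else 0) * signChar (z ⬝ᵥ b) := by
          simp only [← sum_mul, sum_addChar_dotProduct signChar_isPrimitive,
            add_eq_zero_iff_eq_neg, Fintype.card_pi_const, ZMod.card]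
          push_cast
          rfl
      _ = 2 ^ r * signChar (-a ⬝ᵥ b) := by simp
  change |(innerProduct r).walsh (Fin.append a b)| = _
  rw [walsh_eq_sum_signChar, hsum, pow_add,
    Real.sqrt_mul_self (by positivity), abs_div, abs_mul, abs_signChar,
    abs_of_pos (by positivity : (0 : ℝ) < 2 ^ r), abs_of_pos (by positivity)]
  field_simp

theorem exists_isBent (hn : Even n) : ∃ f : BoolFun n, f.IsBent := by
  obtain ⟨r, rfl⟩ := hn
  exact ⟨innerProduct r, isBent_innerProduct r⟩

theorem IsBent.exists_walshMax_flipOn_eq {f : BoolFun n} (hf : f.IsBent) (hn : 4 ≤ 2 ^ n) :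
    ∃ D : Finset (Fin n → ZMod 2), 2 ^ n ≤ 4 * #D ∧
      ∀ S ⊆ D, (f.flipOn S).walshMax = 1 / √(2 ^ n) + 2 * #S / 2 ^ n := by
  obtain ⟨b, hb⟩ : ∃ b, signChar b * f.walsh 0 = -(1 / √(2 ^ n)) := by
    obtain ⟨b, hb⟩ := exists_signChar_mul_eq_abs (-f.walsh 0)
    exact ⟨b, by rw [← hf 0, ← abs_neg, ← hb, mul_neg, neg_neg]⟩
  refine ⟨({x | f x = b} : Finset _), ?_, fun S hS => ?_⟩
  · have hsqrt : 1 / √((2 : ℝ) ^ n) ≤ 1 / 2 := by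
      gcongr
      exact Real.le_sqrt_of_sq_le (by norm_num; exact_mod_cast hn)
    have hcard : (#{x | f x = b} : ℝ) = 2 ^ n * (1 - 1 / √(2 ^ n)) / 2 := by
      rw [card_filter_eq_sum_signChar, sub_eq_add_neg, ← hb, walsh_eq_sum_signChar,
        Fintype.card_pi_const, ZMod.card]
      simp only [dotProduct_zero, add_zero]
      push_cast
      field_simp
    rw [← Nat.cast_le (α := ℝ)]
    push_cast
    rw [hcard]
    nlinarith
  · refine walshMax_eq_of_forall_le (a := 0) ?_ fun a => ?_
    · have hwalsh : (f.flipOn S).walsh 0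
          = -signChar b * (1 / √(2 ^ n) + 2 * #S / 2 ^ n) := by
        rw [walsh_flipOn_zero fun x hx => (mem_filter.mp (hS hx)).2, mul_add, neg_mul,
          ← mul_neg, ← hb, ← mul_assoc, signChar_mul_self]
        ring
      rw [hwalsh, abs_mul, abs_neg, abs_signChar, one_mul, abs_of_nonneg (by positivity)]
    · rw [← hf a]
      exact abs_walsh_flipOn_le f S a

end BoolFun

theorem exists_lt_natCast_div_two_pow {n : ℕ} {μ : ℝ} (hμ : 1 / 2 ^ (n + 1) ≤ μ)
    (hμ' : μ < 1 / 4) : ∃ k : ℕ, μ < k / 2 ^ n ∧ 4 * k ≤ 2 ^ n ∧ k ≤ 2 ^ n * μ + 1 := by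
  have hn : 2 ≤ n := by
    have hpow : (2 : ℝ) ^ 2 < 2 ^ (n + 1) :=
      lt_of_one_div_lt_one_div (by positivity) (by linarith)
    exact Nat.lt_succ_iff.mp ((pow_lt_pow_iff_right₀ one_lt_two).mp hpow)
  obtain ⟨l, rfl⟩ := Nat.exists_eq_add_of_le' hn
  have hμ₀ : 0 ≤ μ := le_trans (by positivity) hμ
  refine ⟨⌊2 ^ (l + 2) * μ⌋₊ + 1, ?_, ?_, ?_⟩
  · rw [lt_div_iff₀' (by positivity)]
    exact_mod_cast Nat.lt_floor_add_one _
  · have hfloor : ⌊2 ^ (l + 2) * μ⌋₊ < 2 ^ l := by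
      rw [Nat.floor_lt (by positivity), pow_add]
      push_cast
      nlinarith [pow_pos (two_pos (α := ℝ)) l]
    calc 4 * (⌊2 ^ (l + 2) * μ⌋₊ + 1) ≤ 4 * 2 ^ l := by gcongr; exact hfloor
      _ = 2 ^ (l + 2) := by ring
  · push_cast
    gcongr
    exact Nat.floor_le (by positivity)

namespace QueryAlgorithm

open BoolFun

variable {n : ℕ} {α : Type}

theorem div_sqrt_le_queries_of_flipOn_zero (A : QueryAlgorithm n α) {k : ℕ} (hk : 4 * k ≤ 2 ^ n)
    {lam δ : ℝ} (hlam : 0 < lam) (hklam : k ≤ 4 * lam * 2 ^ n) {R R' : Set α}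
    (hR : Disjoint R R') (hf : 1 - δ ≤ A.prob 0 R)
    (hflip : ∀ S, #S = k → 1 - δ ≤ A.prob ((0 : BoolFun n).flipOn S) R') :
    (1 - 2 * δ) / 16 / √lam ≤ A.queries := by
  have hcard : #(univ : Finset (Fin n → ZMod 2)) = 2 ^ n := by simp
  refine A.div_sqrt_le_queries (D := univ) (k := k) (by omega) (by positivity) hlam ?_ hR hf
    fun S _ => hflip S
  rw [hcard]
  push_cast
  linarith [mul_pos hlam (pow_pos (two_pos (α := ℝ)) n)]

theorem div_sqrt_le_queries_of_nonlinearity (A : QueryAlgorithm n α) {lam μ δ : ℝ}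
    (hlam : 1 / 2 ^ (n + 1) ≤ lam) (hlamμ : lam ≤ μ) (hμlam : μ ≤ 2 * lam) (hμ : μ < 1 / 4)
    {R : ℝ → Set α} (hR : ∀ v, μ < v → Disjoint (R 0) (R v))
    (hA : ∀ f, 1 - δ ≤ A.prob f (R f.nonlinearity)) :
    (1 - 2 * δ) / 16 / √lam ≤ A.queries := by
  obtain ⟨k, hμk, hk, hk'⟩ := exists_lt_natCast_div_two_pow (hlam.trans hlamμ) hμ
  have hlam₁ : 1 ≤ lam * (2 * 2 ^ n) := by
    rwa [div_le_iff₀ (by positivity), pow_succ'] at hlam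
  have hlam₀ : 0 < lam := lt_of_lt_of_le (by positivity) hlam
  have hklam : k ≤ 4 * lam * 2 ^ n :=
    calc (k : ℝ) ≤ 2 ^ n * μ + 1 := hk'
      _ ≤ 2 ^ n * (2 * lam) + lam * (2 * 2 ^ n) := by gcongr
      _ = 4 * lam * 2 ^ n := by ring
  refine A.div_sqrt_le_queries_of_flipOn_zero hk hlam₀ hklam (hR _ hμk) ?_ fun S hS => ?_
  · simpa only [nonlinearity_zero] using hA 0
  · simpa only [nonlinearity_flipOn_zero (hS ▸ hk), hS] using hA ((0 : BoolFun n).flipOn S)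

theorem EstimatesByInterval.div_sqrt_le_queries {A : QueryAlgorithm n (ℝ × ℝ)} {lam δ : ℝ}
    (hA : A.EstimatesByInterval lam δ) (hlam : 1 / 2 ^ (n + 1) ≤ lam) (hlam' : lam < 1 / 4) :
    (1 - 2 * δ) / 16 / √lam ≤ A.queries := by
  have hlam₀ : 0 < lam := lt_of_lt_of_le (by positivity) hlam
  refine A.div_sqrt_le_queries_of_nonlinearity
    (R := fun v => {I | I.2 - I.1 ≤ lam ∧ v ∈ Set.Icc I.1 I.2}) hlam le_rfl (by linarith) hlam'
    (fun v hv => ?_) hA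
  rw [Set.disjoint_left]
  rintro I ⟨hlen, hI₀, -⟩ ⟨-, -, hIv⟩
  linarith

theorem EstimatesByNumber.div_sqrt_le_queries {A : QueryAlgorithm n ℝ} {lam δ : ℝ}
    (hA : A.EstimatesByNumber lam δ) (hlam : 1 / 2 ^ (n + 1) ≤ lam) (hlam' : lam < 1 / 8) :
    (1 - 2 * δ) / 16 / √lam ≤ A.queries := by
  have hlam₀ : 0 < lam := lt_of_lt_of_le (by positivity) hlam
  refine A.div_sqrt_le_queries_of_nonlinearity (μ := 2 * lam)
    (R := fun v => {r | |r - v| ≤ lam}) hlam (by linarith) le_rfl (by linarith)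
    (fun v hv => ?_) hA
  rw [Set.disjoint_left]
  intro r (hr₀ : |r - 0| ≤ lam) (hrv : |r - v| ≤ lam)
  linarith [(abs_le.mp hr₀).2, (abs_le.mp hrv).1]

theorem DecidesWalshMax.div_sqrt_le_queries_of_one {A : QueryAlgorithm n Bool} {k : ℕ} {δ : ℝ}
    (hA : A.DecidesWalshMax 1 (1 - 2 * k / 2 ^ n) δ) (hk₀ : 0 < k) (hk : 4 * k ≤ 2 ^ n) :
    (1 - 2 * δ) / 16 / √(k / 2 ^ (n + 1)) ≤ A.queries := by
  refine A.div_sqrt_le_queries_of_flipOn_zero (k := k) hk (by positivity) ?_ (R := {true})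
    (R' := {false}) (by simp) ((hA 0).1 walshMax_zero) fun S hS => (hA _).2 ?_
  · rw [pow_succ']
    field_simp
    norm_num
  · rw [walshMax_flipOn_zero (hS ▸ hk), hS]

theorem DecidesWalshMax.div_sqrt_le_queries_of_bent {A : QueryAlgorithm n Bool} {k : ℕ} {δ : ℝ}
    (hn : Even n)
    (hA : A.DecidesWalshMax (1 / √(2 ^ n)) (1 / √(2 ^ n) + 2 * k / 2 ^ n) δ) (hk₀ : 0 < k)
    (hk : 4 * k ≤ 2 ^ n) : (1 - 2 * δ) / 16 / √(k / 2 ^ (n + 1)) ≤ A.queries := by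
  obtain ⟨f, hf⟩ := exists_isBent hn
  obtain ⟨D, hD, hflip⟩ := hf.exists_walshMax_flipOn_eq (by omega)
  have hklam : (k : ℝ) ≤ 16 * (k / 2 ^ (n + 1)) * #D :=
    calc (k : ℝ) = k / 2 ^ n * 2 ^ n := by field_simp
      _ ≤ k / 2 ^ n * (4 * #D) := by gcongr; exact_mod_cast hD
      _ ≤ 16 * (k / 2 ^ (n + 1)) * #D := by
          rw [pow_succ']
          field_simp
          linarith
  refine A.div_sqrt_le_queries (k := k) (by omega) (by omega) (by positivity) hklam (R := {true})
    (R' := {false}) (by simp) ((hA f).1 hf.walshMax_eq) fun S hS hSk => (hA _).2 ?_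
  rw [hflip S hS, hSk]

end QueryAlgorithm

theorem natCast_div_two_pow_succ_le_iff {k n : ℕ} :
    (k / 2 ^ (n + 1) : ℝ) ≤ 1 / 8 ↔ 4 * k ≤ 2 ^ n := by
  rw [div_le_div_iff₀ (by positivity) (by norm_num), pow_succ', ← Nat.cast_le (α := ℝ)]
  push_cast
  constructor <;> intro h <;> linarith

theorem four_mul_div_two_pow_succ (a : ℝ) (n : ℕ) : 4 * (a / 2 ^ (n + 1)) = 2 * a / 2 ^ n := by
  rw [pow_succ']
  ring

theorem theorem6p5 (δ : ℝ) (hδ₀ : 0 ≤ δ) (hδ : δ < 1 / 2) :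
    ∃ c : ℝ, 0 < c ∧
      (∀ (n : ℕ) (lam : ℝ), 1 / 2 ^ (n + 1) ≤ lam → lam ≤ 1 / 8 →
        ∀ A : QueryAlgorithm n (ℝ × ℝ), A.EstimatesByInterval lam δ →
          c / √lam ≤ A.queries) ∧
      (∀ (n : ℕ) (lam : ℝ), 1 / 2 ^ (n + 1) ≤ lam → lam < 1 / 8 →
        ∀ A : QueryAlgorithm n ℝ, A.EstimatesByNumber lam δ →
          c / √lam ≤ A.queries) ∧
      (∀ (n k : ℕ) (lam : ℝ), 1 ≤ k → lam = k / 2 ^ (n + 1) → lam ≤ 1 / 8 →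
        ∀ A : QueryAlgorithm n Bool, A.DecidesWalshMax 1 (1 - 4 * lam) δ →
          c / √lam ≤ A.queries) ∧
      (∀ (n k : ℕ) (lam : ℝ), Even n → 1 ≤ k → lam = k / 2 ^ (n + 1) → lam ≤ 1 / 8 →
        ∀ A : QueryAlgorithm n Bool,
          A.DecidesWalshMax (1 / √(2 ^ n)) (1 / √(2 ^ n) + 4 * lam) δ →
          c / √lam ≤ A.queries) := by
  refine ⟨(1 - 2 * δ) / 16, by linarith, ?_, ?_, ?_, ?_⟩
  · intro n lam hlam hlam' A hA
    exact hA.div_sqrt_le_queries hlam (by linarith)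
  · intro n lam hlam hlam' A hA
    exact hA.div_sqrt_le_queries hlam hlam'
  · rintro n k _ hk rfl hlam A hA
    rw [four_mul_div_two_pow_succ] at hA
    exact hA.div_sqrt_le_queries_of_one hk (natCast_div_two_pow_succ_le_iff.mp hlam)
  · rintro n k _ hn hk rfl hlam A hA
    rw [four_mul_div_two_pow_succ] at hA
    exact hA.div_sqrt_le_queries_of_bent hn hk (natCast_div_two_pow_succ_le_iff.mp hlam)
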